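/- Let $V$ be a set of $n\ge 2$ nodes and let $G=(V,E)$ be a directed graph without loops, with edge weights $\alpha_{ij}>0$ for $ij\in E$ (the edge $ij$ means that node $i$ measures its offset to node $j$). Let $G$ be connected in the sense that some node can be reached from every node along directed edges. Let $L$ be the weighted Laplacian of $G$: $L_{ii}=\sum_{j:\,ij\in E}\alpha_{ij}$ and, for $i\ne j$, $L_{ij}=-\alpha_{ij}$ if $ij\in E$ and $L_{ij}=0$ otherwise. Let $R=\mathrm{diag}(r_i)$ with clock rates $r_i>0$, let $\tau>0$ be the time between updates, $t_k=t_0+k\tau$, and let $\kappa_1,\kappa_2,p\in\mathbb R$. Consider the system $z_{k+1}=Az_k$ with $z_k=(x(t_k),s(t_k),y(t_k))\in\mathbb R^{3n}$ and $$A=\begin{pmatrix} I & \tau R & 0\\ -\kappa_1 L & I & -\kappa_2 I\\ -pL & 0 & (1-p)I\end{pmatrix}.$$ Assume that all eigenvalues of the rate-weighted Laplacian $LR$ are real, and let $\mu_{\max}$ be the largest of them. The system is said to synchronize if for every initial condition $z_0$ there are real numbers $r^*$ and $x^*$ such that $x_i(t_k)-\bigl(r^*(t_k-t_0)+x^*\bigr)\to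 0$ as $k\to\infty$ for every $i\in V$. Then the system synchronizes if and only if the following three conditions hold: (i) $0<p<2$; (ii) $\dfrac{2\kappa_1}{3p}>\kappa_1-\kappa_2>0$; (iii) $\tau<\dfrac{p\,(\kappa_2-p(\kappa_1-\kappa_2))}{\mu_{\max}\,(\kappa_1-p(\kappa_1-\kappa_2))^2}$. -/

import Mathlib

open Filter Topology

/-- Connectedness of the directed graph of a network, in which an edge `i → j` means that
node `i` measures its offset to node `j`: there is a node that every node reaches along
directed edges (the edges contain a spanning tree directed towards that node). -/
def NetworkConnected {V : Type*} (G : Digraph V) : Prop :=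
  ∃ root : V, ∀ i : V, Relation.ReflTransGen G.Adj i root

open Classical in
/-- The weighted Laplacian of a directed graph without loops:
`L i i` is the sum of the weights `α i j` over the out-neighbours `j` of `i`, and for `i ≠ j`
the entry `L i j` is `-α i j` if `i → j` is an edge and `0` otherwise. -/
noncomputable def networkLaplacian {V : Type*} [Fintype V] (G : Digraph V) (α : V → V → ℝ) :
    Matrix V V ℝ :=
  Matrix.of fun i j =>
    if i = j then ∑ k with G.Adj i k, α i k else if G.Adj i j then -α i j else 0

/-- All complex eigenvalues of a real square matrix are real. -/
def HasRealEigenvalues {V : Type*} [Fintype V] [DecidableEq V] (M : Matrix V V ℝ) : Prop :=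
  ∀ μ : ℂ, Module.End.HasEigenvalue (Matrix.toLin' (M.map Complex.ofReal)) μ → μ.im = 0

/-- The system matrix
`[[I, τ R, 0], [-κ₁ L, I, -κ₂ I], [-p L, 0, (1 - p) I]]` with `R = diag r`; the three blocks of
coordinates are the clocks `x`, the skew corrections `s` and the moving averages `y`. -/
def systemMatrix {V : Type*} [DecidableEq V] (L : Matrix V V ℝ) (r : V → ℝ)
    (κ₁ κ₂ p τ : ℝ) : Matrix (V ⊕ (V ⊕ V)) (V ⊕ (V ⊕ V)) ℝ :=
  Matrix.fromBlocks
    1 (Matrix.fromCols (τ • Matrix.diagonal r) 0)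
    (Matrix.fromRows (-κ₁ • L) (p • (-L)))
    (Matrix.fromBlocks 1 (-κ₂ • (1 : Matrix V V ℝ)) 0 ((1 - p) • (1 : Matrix V V ℝ)))

/-- The system `z (k+1) = A z k` synchronizes: from every initial condition, there are a common
rate `rs` and a common offset `xs` such that the clocks `x i (t k)` approach
`rs * (t k - t 0) + xs`, where `t k - t 0 = k * τ`. -/
def Synchronizes {V : Type*} [Fintype V] [DecidableEq V] (L : Matrix V V ℝ) (r : V → ℝ)
    (κ₁ κ₂ p τ : ℝ) : Prop :=
  ∀ z : ℕ → (V ⊕ (V ⊕ V) → ℝ),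
    (∀ k, z (k + 1) = (systemMatrix L r κ₁ κ₂ p τ).mulVec (z k)) →
      ∃ rs xs : ℝ, ∀ i : V,
        Tendsto (fun k : ℕ => z k (Sum.inl i) - (rs * ((k : ℝ) * τ) + xs)) atTop (𝓝 0)

/-!
Eliminating the skew corrections and the averages leaves a third-order recurrence for the clocks,
`D ^ 3 x + p D ^ 2 x + τ κ₁ M D x + τ p (κ₁ - κ₂) M x = 0`, where `D` is the forward difference and
`M = R L` (`clockRecurrence_of_trajectory`). On the mode of an eigenvalue `μ` of `M`, which is also
an eigenvalue of `L R`, the characteristic polynomial in `q = λ - 1` is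
`q ^ 3 + p q ^ 2 + τ κ₁ μ q + τ p (κ₁ - κ₂) μ`.

By the maximum principle for the Laplacian, the kernel of `M` consists of the constant vectors, `1`
is not in the range of `M`, and the eigenvalues are nonnegative; the trace of `M` is positive, so
`μmax > 0`.

The Jury criterion (`cubic_coeffs_of_stable`, `exists_stable_roots_of_cubic`) says, for
`0 < p < 2`, that all roots satisfy `|1 + q| < 1` if and only if `0 < γ < (p - (β - γ)) (β - γ)`,
where `β` and `γ` are the two last coefficients. Both halves divide the cubic by a real linear
factor. For `μ > 0` these inequalities amount to `κ₁ > κ₂` and the bound on `τ` with `μ` in place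
of `μmax`, so the largest eigenvalue is the decisive one. The remaining condition
`2 κ₁ > 3 p (κ₁ - κ₂)` follows from the Jury inequalities when `p < 2`; it keeps the denominator of the bound on
`τ` nonzero.

For necessity, a trajectory on an eigenvector of `μmax` has to decay, since the eigenvector is not
constant (`stableMode_of_modes`), and on the constant eigenvector the second differences are
multiples of `(1 - p) ^ k`, which yields `0 < p < 2` (`Synchronizes.p_mem`). For sufficiency,
`M x` tends to zero: the linear factors of the characteristic polynomial of `M` are peeled off one
at a time (`ClockRecurrence.tendsto_zero_of_aeval_prod`), so that no diagonalization is needed. A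
functional `w` that vanishes on the range of `M` and has `w 1 = 1` gives the weighted mean `w x`,
which is affine plus a multiple of `(1 - p) ^ k`. Since `M` and `w` are jointly injective, all
clocks approach this affine function (`synchronizes_of_stableMode`).
-/

/-! ### Schur stability of real quadratics and cubics in the shifted variable -/

theorem stable_root_of_quadratic {s t : ℝ} (ht : 0 < t) (hst : t < s) (h2 : 0 < 4 - 2 * s + t)
    {q : ℂ} (hq : q ^ 2 + s * q + t = 0) : ‖1 + q‖ < 1 := by
  have hre := congrArg Complex.re hq
  have him := congrArg Complex.im hq
  simp [pow_two] at hre him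
  have hn : ‖1 + q‖ ^ 2 < 1 := by
    rw [← Complex.normSq_eq_norm_sq, Complex.normSq_apply]
    simp only [Complex.add_re, Complex.one_re, Complex.add_im, Complex.one_im, zero_add]
    by_cases hy : q.im = 0
    · simp only [hy, mul_zero, sub_zero, add_zero] at hre ⊢
      have h0 : q.re < 0 := by
        by_contra! h
        nlinarith [mul_nonneg h h, mul_nonneg (ht.trans hst).le h]
      have hm2 : -2 < q.re := by
        by_contra! h
        -- the vertex `-s / 2` lies to the right of `-2`, and the value at `-2` is positive
        nlinarith [mul_nonneg (by linarith : 0 ≤ -2 - q.re) (by linarith : 0 ≤ 2 - q.re - s)]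
      nlinarith
    · have hx : 2 * q.re = -s := by
        apply mul_right_cancel₀ hy
        linarith
      nlinarith
  nlinarith [norm_nonneg (1 + q)]

theorem quadratic_coeffs_of_stable {s t : ℝ}
    (h : ∀ q : ℂ, q ^ 2 + s * q + t = 0 → ‖1 + q‖ < 1) :
    0 < t ∧ t < s ∧ 0 < 4 - 2 * s + t := by
  have hreal : ∀ x : ℝ, x ^ 2 + s * x + t = 0 → -2 < x ∧ x < 0 := by
    intro x hx
    have := h x (by exact_mod_cast hx)
    rw [← Complex.ofReal_one, ← Complex.ofReal_add, Complex.norm_real, Real.norm_eq_abs,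
      abs_lt] at this
    constructor <;> linarith
  refine ⟨?_, ?_, ?_⟩
  · by_contra! ht
    have hd : 0 ≤ s ^ 2 - 4 * t := by nlinarith [sq_nonneg s]
    have h1 := (hreal ((-s + √(s ^ 2 - 4 * t)) / 2) (by linarith [Real.sq_sqrt hd])).2
    have h2 : |s| ≤ √(s ^ 2 - 4 * t) := Real.abs_le_sqrt (by linarith)
    linarith [le_abs_self s]
  · obtain ⟨w, hw⟩ := IsAlgClosed.exists_eq_mul_self ((s : ℂ) ^ 2 - 4 * t)
    have h1 := h ((-s + w) / 2) (by linear_combination (-1 / 4 : ℂ) * hw)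
    have h2 := h ((-s - w) / 2) (by linear_combination (-1 / 4 : ℂ) * hw)
    have h3 : (1 + (-s + w) / 2) * (1 + (-s - w) / 2) = ((1 - s + t : ℝ) : ℂ) := by
      push_cast
      linear_combination (1 / 4 : ℂ) * hw
    have h4 : ‖((1 - s + t : ℝ) : ℂ)‖ < 1 := by
      rw [← h3, norm_mul]
      exact mul_lt_one_of_nonneg_of_lt_one_left (norm_nonneg _) h1 h2.le
    rw [Complex.norm_real, Real.norm_eq_abs, abs_lt] at h4
    linarith
  · by_contra! ht
    have hd' : (4 - s) ^ 2 ≤ s ^ 2 - 4 * t := by linarith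
    have hd : 0 ≤ s ^ 2 - 4 * t := (sq_nonneg _).trans hd'
    have h1 := (hreal ((-s - √(s ^ 2 - 4 * t)) / 2) (by linarith [Real.sq_sqrt hd])).1
    have h2 : |4 - s| ≤ √(s ^ 2 - 4 * t) := Real.abs_le_sqrt hd'
    linarith [le_abs_self (4 - s)]

theorem exists_real_root_cubic (p β γ : ℝ) : ∃ x : ℝ, x ^ 3 + p * x ^ 2 + β * x + γ = 0 := by
  set K := 1 + |p| + |β| + |γ| with hK
  have hc : Continuous fun x : ℝ => x ^ 3 + p * x ^ 2 + β * x + γ := by fun_prop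
  have hp := abs_le.1 (le_refl |p|)
  have hβ := abs_le.1 (le_refl |β|)
  have hγ := abs_le.1 (le_refl |γ|)
  have hp0 := abs_nonneg p
  have hβ0 := abs_nonneg β
  have hγ0 := abs_nonneg γ
  have hK1 : 1 ≤ K := by linarith
  have hK2 : K ≤ K ^ 2 := by nlinarith
  have e : K ^ 3 = K ^ 2 + |p| * K ^ 2 + |β| * K ^ 2 + |γ| * K ^ 2 := by
    rw [hK]; ring
  have b1 : |β| * K ≤ |β| * K ^ 2 := mul_le_mul_of_nonneg_left hK2 hβ0
  have b2 : |γ| * 1 ≤ |γ| * K ^ 2 := mul_le_mul_of_nonneg_left (hK1.trans hK2) hγ0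
  refine mem_range_of_exists_le_of_exists_ge hc ⟨-K, ?_⟩ ⟨K, ?_⟩
  · have h1 : p * K ^ 2 ≤ |p| * K ^ 2 := mul_le_mul_of_nonneg_right hp.2 (by positivity)
    have h2 : -|β| * K ≤ β * K := mul_le_mul_of_nonneg_right hβ.1 (by linarith)
    nlinarith
  · have h1 : -|p| * K ^ 2 ≤ p * K ^ 2 := mul_le_mul_of_nonneg_right hp.1 (by positivity)
    have h2 : -|β| * K ≤ β * K := mul_le_mul_of_nonneg_right hβ.1 (by linarith)
    nlinarith

/-- The necessary half of the Jury criterion for `q ^ 3 + p q ^ 2 + β q + γ`, where stability means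
that `1 + q` lies in the open unit disc for each root `q`. -/
theorem cubic_coeffs_of_stable {p β γ : ℝ}
    (h : ∀ q : ℂ, q ^ 3 + p * q ^ 2 + β * q + γ = 0 → ‖1 + q‖ < 1) :
    0 < γ ∧ γ < (p - (β - γ)) * (β - γ) := by
  obtain ⟨ρ, hρ⟩ := exists_real_root_cubic p β γ
  obtain ⟨σ, rfl⟩ : ∃ σ, ρ = -σ := ⟨-ρ, by ring⟩
  -- divide the cubic by `q + σ`
  obtain ⟨s, rfl⟩ : ∃ s, p = s + σ := ⟨p - σ, by ring⟩
  obtain ⟨t, rfl⟩ : ∃ t, β = t + σ * s := ⟨β - σ * s, by ring⟩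
  obtain rfl : γ = σ * t := by linear_combination hρ
  have hσ : 0 < σ ∧ σ < 2 := by
    have := h (-σ : ℝ) (by push_cast; ring)
    rw [← Complex.ofReal_one, ← Complex.ofReal_add, Complex.norm_real, Real.norm_eq_abs,
      abs_lt] at this
    constructor <;> linarith
  obtain ⟨ht, hst, h2⟩ := quadratic_coeffs_of_stable (s := s) (t := t) fun q hq =>
    h q (by push_cast; linear_combination (q + σ) * hq)
  refine ⟨mul_pos hσ.1 ht, ?_⟩
  obtain ⟨d, rfl⟩ : ∃ d, s = t + d := ⟨s - t, by ring⟩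
  have hd : 0 < d := by linarith
  have key : 0 < t * (1 - σ) + σ * d * (1 - σ) + σ ^ 2 := by
    rcases le_total σ 1 with h1 | h1
    · have := mul_nonneg ht.le (sub_nonneg.2 h1)
      have := mul_nonneg (mul_pos hσ.1 hd).le (sub_nonneg.2 h1)
      have := pow_pos hσ.1 2
      linarith
    · have h4 : t + σ * d ≤ 4 := by nlinarith
      nlinarith [mul_le_mul_of_nonneg_right h4 (sub_nonneg.2 h1), sq_nonneg (σ - 2)]
  have := mul_pos hd key
  linarith

/-- The sufficient half of the Jury criterion: besides bounding the roots, it splits the cubic into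
complex linear factors, in the form of Vieta's formulas. -/
theorem exists_stable_roots_of_cubic {p β γ : ℝ} (hp : 0 < p) (hp2 : p < 2) (hγ : 0 < γ)
    (h : γ < (p - (β - γ)) * (β - γ)) :
    ∃ q₁ q₂ q₃ : ℂ, ‖1 + q₁‖ < 1 ∧ ‖1 + q₂‖ < 1 ∧ ‖1 + q₃‖ < 1 ∧
      (p : ℂ) = -(q₁ + q₂ + q₃) ∧ (β : ℂ) = q₁ * q₂ + q₁ * q₃ + q₂ * q₃ ∧
      (γ : ℂ) = -(q₁ * q₂ * q₃) := by
  have hb : 0 < β - γ := by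
    by_contra! hb
    nlinarith
  have hu : 0 < p - (β - γ) := by
    by_contra! hu
    nlinarith
  obtain ⟨ρ, hρI, hρ⟩ : ∃ ρ ∈ Set.Ioo (-2 : ℝ) 0, ρ ^ 3 + p * ρ ^ 2 + β * ρ + γ = 0 :=
    intermediate_value_Ioo (by norm_num)
      (f := fun x : ℝ => x ^ 3 + p * x ^ 2 + β * x + γ) (by fun_prop)
      ⟨by norm_num; linarith, by norm_num; linarith⟩
  obtain ⟨σ, rfl⟩ : ∃ σ, ρ = -σ := ⟨-ρ, by ring⟩
  have hσ : 0 < σ := by linarith [hρI.2]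
  have hσ2 : σ < 2 := by linarith [hρI.1]
  -- divide the cubic by `q + σ`
  obtain ⟨s, rfl⟩ : ∃ s, p = s + σ := ⟨p - σ, by ring⟩
  obtain ⟨t, rfl⟩ : ∃ t, β = t + σ * s := ⟨β - σ * s, by ring⟩
  obtain rfl : γ = σ * t := by linear_combination hρ
  have ht : 0 < t := pos_of_mul_pos_right hγ hσ.le
  have h2 : 0 < 4 - 2 * s + t := by
    refine pos_of_mul_pos_right (a := 2 - σ) ?_ (by linarith)
    nlinarith
  have hst : t < s := by
    by_contra! hst
    have key : 0 < (s - t) * ((1 - σ) * (t + σ * s - σ * t) + σ ^ 2) := by linarith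
    have key2 : (1 - σ) * (t + σ * s - σ * t) + σ ^ 2 ≤ 0 := by
      by_contra! h3
      nlinarith
    nlinarith [sq_nonneg (σ - 2)]
  obtain ⟨w, hw⟩ := IsAlgClosed.exists_eq_mul_self ((s : ℂ) ^ 2 - 4 * t)
  refine ⟨-σ, (-s + w) / 2, (-s - w) / 2, ?_, ?_, ?_, ?_, ?_, ?_⟩
  · rw [← Complex.ofReal_neg, ← Complex.ofReal_one, ← Complex.ofReal_add, Complex.norm_real,
      Real.norm_eq_abs, abs_lt]
    constructor <;> linarith
  · exact stable_root_of_quadratic ht hst h2 (by linear_combination (-1 / 4 : ℂ) * hw)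
  · exact stable_root_of_quadratic ht hst h2 (by linear_combination (-1 / 4 : ℂ) * hw)
  · push_cast; ring
  · push_cast; linear_combination (-1 / 4 : ℂ) * hw
  · push_cast; linear_combination (-σ / 4 : ℂ) * hw

/-! ### Linear recurrences with vanishing forcing -/

theorem tendsto_zero_of_sub_mul_tendsto_zero {u : ℕ → ℂ} {c : ℂ} (hc : ‖c‖ < 1)
    (hu : Tendsto (fun k => u (k + 1) - c * u k) atTop (𝓝 0)) : Tendsto u atTop (𝓝 0) := by
  rw [Metric.tendsto_atTop] at hu ⊢
  intro ε hε
  have hc' : 0 < 1 - ‖c‖ := by linarith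
  obtain ⟨N, hN⟩ := hu (ε / 2 * (1 - ‖c‖)) (by positivity)
  have hb : ∀ m, ‖u (N + m)‖ ≤ ‖c‖ ^ m * ‖u N‖ + ε / 2 := by
    intro m
    induction m with
    | zero => simp; linarith
    | succ m ih =>
      have h1 := hN (N + m) (by omega)
      rw [dist_zero_right] at h1
      have h2 : ‖u (N + m + 1)‖ ≤ ‖u (N + m + 1) - c * u (N + m)‖ + ‖c‖ * ‖u (N + m)‖ := by
        rw [← norm_mul]
        exact norm_le_norm_sub_add _ _
      have h3 := mul_le_mul_of_nonneg_left ih (norm_nonneg c)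
      rw [← add_assoc, pow_succ]
      linarith
  have hlim : Tendsto (fun m => ‖c‖ ^ m * ‖u N‖) atTop (𝓝 0) := by
    simpa using (tendsto_pow_atTop_nhds_zero_of_lt_one (norm_nonneg c) hc).mul_const ‖u N‖
  obtain ⟨m₀, hm₀⟩ := eventually_atTop.1 (hlim.eventually_lt_const (half_pos hε))
  refine ⟨N + m₀, fun n hn => ?_⟩
  obtain ⟨m, rfl⟩ := Nat.exists_eq_add_of_le (show N ≤ n by omega)
  rw [dist_zero_right]
  linarith [hb m, hm₀ m (by omega)]

/-- The characteristic polynomial of this recurrence is `q ^ 3 + p q ^ 2 + β q + γ` in the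
forward difference `q`. -/
theorem tendsto_zero_of_stable_cubic {p β γ : ℝ} (hp : 0 < p) (hp2 : p < 2) (hγ : 0 < γ)
    (h : γ < (p - (β - γ)) * (β - γ)) {x : ℕ → ℝ}
    (hx : Tendsto (fun k => x (k + 3) - (3 - p) * x (k + 2) + (3 - 2 * p + β) * x (k + 1)
      - (1 - p + β - γ) * x k) atTop (𝓝 0)) : Tendsto x atTop (𝓝 0) := by
  obtain ⟨q₁, q₂, q₃, h₁, h₂, h₃, hpq, hβq, hγq⟩ := exists_stable_roots_of_cubic hp hp2 hγ h
  have hC : Tendsto (fun k => (x k : ℂ)) atTop (𝓝 0) := by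
    refine tendsto_zero_of_sub_mul_tendsto_zero h₁ ?_
    refine tendsto_zero_of_sub_mul_tendsto_zero h₂ ?_
    refine tendsto_zero_of_sub_mul_tendsto_zero h₃ ?_
    rw [← Complex.ofReal_zero]
    refine ((Complex.continuous_ofReal.tendsto _).comp hx).congr fun k => ?_
    simp only [Function.comp_apply]
    push_cast
    rw [hpq, hβq, hγq]
    ring
  exact (Complex.continuous_re.tendsto 0).comp hC

/-- The third-order recurrence
`D ^ 3 x + p D ^ 2 x + c₁ T D x + c₀ T x = 0`, with `D` the forward difference, that the clocks
satisfy after the other two state variables are eliminated. -/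
def ClockRecurrence {E : Type*} [AddCommGroup E] [Module ℝ E] (T : Module.End ℝ E)
    (c₁ c₀ p : ℝ) (x : ℕ → E) : Prop :=
  ∀ k, x (k + 3) = (3 - p) • x (k + 2) - (3 - 2 * p) • x (k + 1) + (1 - p) • x k
    - c₁ • T (x (k + 1) - x k) - c₀ • T (x k)

/-- The Jury conditions for the mode of the eigenvalue `μ`, whose characteristic polynomial is
`q ^ 3 + p q ^ 2 + c₁ μ q + c₀ μ`. -/
def StableMode (c₁ c₀ p μ : ℝ) : Prop :=
  0 < c₀ * μ ∧ c₀ * μ < (p - (c₁ * μ - c₀ * μ)) * (c₁ * μ - c₀ * μ)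

theorem ClockRecurrence.map {E : Type*} [AddCommGroup E] [Module ℝ E] {T : Module.End ℝ E}
    {c₁ c₀ p : ℝ} {x : ℕ → E} (hx : ClockRecurrence T c₁ c₀ p x) {f : Module.End ℝ E}
    (hf : Commute f T) : ClockRecurrence T c₁ c₀ p fun k => f (x k) := by
  have hfT : ∀ v, f (T v) = T (f v) := fun v => LinearMap.congr_fun hf v
  intro k
  simp only [hx k, map_add, map_sub, map_smul, hfT]

theorem ClockRecurrence.tendsto_zero_of_stableMode {V : Type*} {T : Module.End ℝ (V → ℝ)}
    {c₁ c₀ p μ : ℝ} {x : ℕ → V → ℝ} (hx : ClockRecurrence T c₁ c₀ p x) (hp : 0 < p) (hp2 : p < 2)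
    (hμ : StableMode c₁ c₀ p μ)
    (h : Tendsto (fun k => T (x k) - μ • x k) atTop (𝓝 0)) : Tendsto x atTop (𝓝 0) := by
  rw [tendsto_pi_nhds] at h ⊢
  intro i
  refine tendsto_zero_of_stable_cubic hp hp2 hμ.1 hμ.2 ?_
  have h1 := ((tendsto_add_atTop_iff_nat 1).2 (h i)).const_mul (-c₁)
  have h2 := (h i).const_mul (c₁ - c₀)
  have h3 := h1.add h2
  simp only [Pi.zero_apply, mul_zero, add_zero] at h3
  refine h3.congr fun k => ?_
  have e := congrFun (hx k) i
  simp only [map_sub, Pi.add_apply, Pi.sub_apply, Pi.smul_apply, smul_eq_mul] at e ⊢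
  rw [e]
  ring

/-- Factors of an annihilating polynomial are peeled off one at a time, so that `T` need not be
diagonalizable. A factor `X` is harmless on sequences in the range of `T` once `T` is injective
there. -/
theorem ClockRecurrence.tendsto_zero_of_aeval_prod {V : Type*} {T : Module.End ℝ (V → ℝ)}
    {c₁ c₀ p : ℝ} (hp : 0 < p) (hp2 : p < 2)
    (hT : ∀ x : ℕ → V → ℝ, (∀ k, x k ∈ LinearMap.range T) →
      Tendsto (fun k => T (x k)) atTop (𝓝 0) → Tendsto x atTop (𝓝 0))
    (S : Multiset ℝ) (hS : ∀ μ ∈ S, μ = 0 ∨ StableMode c₁ c₀ p μ) :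
    ∀ x : ℕ → V → ℝ, ClockRecurrence T c₁ c₀ p x → (∀ k, x k ∈ LinearMap.range T) →
      Tendsto (fun k => Polynomial.aeval T
        (S.map fun a => Polynomial.X - Polynomial.C a).prod (x k)) atTop (𝓝 0) →
      Tendsto x atTop (𝓝 0) := by
  induction S using Multiset.induction with
  | empty => intro x _ _ h; simpa using h
  | cons μ S ih =>
    intro x hx hran h
    have hf : Commute (T - algebraMap ℝ _ μ) T :=
      (Commute.refl T).sub_left (Algebra.commutes μ T)
    have h1 : Tendsto (fun k => (T - algebraMap ℝ _ μ) (x k)) atTop (𝓝 0) := by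
      refine ih (fun a ha => hS a (Multiset.mem_cons_of_mem ha)) _ (hx.map hf) (fun k => ?_) ?_
      · obtain ⟨v, hv⟩ := hran k
        exact ⟨(T - algebraMap ℝ _ μ) v, by
          rw [← hv]; exact (LinearMap.congr_fun hf v).symm⟩
      · refine h.congr fun k => ?_
        rw [Multiset.map_cons, Multiset.prod_cons, mul_comm, map_mul, Module.End.mul_apply]
        simp
    rcases hS μ (Multiset.mem_cons_self μ S) with rfl | hμ
    · exact hT x hran (by simpa using h1)
    · refine hx.tendsto_zero_of_stableMode hp hp2 hμ (h1.congr fun k => ?_)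
      simp [Module.algebraMap_end_apply]

/-! ### The rate-weighted Laplacian and the maximum principle -/

theorem networkLaplacian_mulVec {V : Type*} [Fintype V] {G : Digraph V}
    (hloop : ∀ i, ¬ G.Adj i i) (α : V → V → ℝ) (x : V → ℝ) (i : V) :
    (networkLaplacian G α).mulVec x i =
      open Classical in ∑ j with G.Adj i j, α i j * (x i - x j) := by
  classical
  have h : ∀ j, networkLaplacian G α i j * x j =
      (if j = i then (∑ k with G.Adj i k, α i k) * x i else 0) -
        if G.Adj i j then α i j * x j else 0 := by
    intro j
    rcases eq_or_ne j i with rfl | hj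
    · simp [networkLaplacian, hloop]
    · simp only [networkLaplacian, Matrix.of_apply, if_neg hj, if_neg hj.symm]
      split_ifs <;> ring
  simp only [Matrix.mulVec, dotProduct, h, Finset.sum_sub_distrib, mul_sub, Finset.sum_ite_eq',
    Finset.mem_univ, if_true, Finset.sum_mul]
  simp only [Finset.sum_filter]

section Laplacian

variable {V : Type*} [Fintype V] {G : Digraph V} {α : V → V → ℝ}

theorem mulVec_le_zero_of_isMin (hloop : ∀ i, ¬ G.Adj i i)
    (hα : ∀ i j, G.Adj i j → 0 < α i j) {x : V → ℝ} {i : V} (hi : ∀ j, x i ≤ x j) :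
    (networkLaplacian G α).mulVec x i ≤ 0 := by
  classical
  rw [networkLaplacian_mulVec hloop]
  refine Finset.sum_nonpos fun j hj => ?_
  exact mul_nonpos_of_nonneg_of_nonpos (hα i j (by simpa using hj)).le (sub_nonpos.2 (hi j))

/-- A solution of `L x = 0` takes its minimal value at a node that every node reaches: the set of
minimizers is closed under passing to out-neighbours. -/
theorem root_isMin_of_mulVec_eq_zero (hloop : ∀ i, ¬ G.Adj i i)
    (hα : ∀ i j, G.Adj i j → 0 < α i j) {x : V → ℝ}
    (hx : (networkLaplacian G α).mulVec x = 0) {root : V}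
    (hroot : ∀ i, Relation.ReflTransGen G.Adj i root) (j : V) : x root ≤ x j := by
  classical
  have : Nonempty V := ⟨root⟩
  obtain ⟨m, hm⟩ := Finite.exists_min x
  suffices H : ∀ i, Relation.ReflTransGen G.Adj m i → x i = x m from
    (H root (hroot m)).trans_le (hm j)
  intro i hi
  induction hi with
  | refl => rfl
  | @tail b c _ hbc ih =>
    have h0 := congrFun hx b
    rw [networkLaplacian_mulVec hloop, Pi.zero_apply, Finset.sum_eq_zero_iff_of_nonpos] at h0
    · have h1 := h0 c (by simpa using hbc)
      have h2 := (mul_eq_zero.1 h1).resolve_left (hα b c hbc).ne'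
      linarith
    · intro k hk
      exact mul_nonpos_of_nonneg_of_nonpos (hα b k (by simpa using hk)).le
        (sub_nonpos.2 (by rw [ih]; exact hm k))

theorem mulVec_eq_zero_iff_const (hloop : ∀ i, ¬ G.Adj i i)
    (hα : ∀ i j, G.Adj i j → 0 < α i j) (hconn : NetworkConnected G) (x : V → ℝ) :
    (networkLaplacian G α).mulVec x = 0 ↔ ∃ c, x = fun _ => c := by
  constructor
  · intro hx
    obtain ⟨root, hroot⟩ := hconn
    refine ⟨x root, funext fun j => le_antisymm ?_
      (root_isMin_of_mulVec_eq_zero hloop hα hx hroot j)⟩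
    have := root_isMin_of_mulVec_eq_zero hloop hα (x := -x)
      (by rw [Matrix.mulVec_neg, hx, neg_zero]) hroot j
    simpa using this
  · rintro ⟨c, rfl⟩
    funext i
    rw [networkLaplacian_mulVec hloop]
    simp

variable [DecidableEq V] {r : V → ℝ}

/-- The operator `x ↦ R L x`. It is conjugate to `L R`, and it is the one that acts on the
clocks `x`. -/
noncomputable def clockOperator (L : Matrix V V ℝ)
    (r : V → ℝ) : Module.End ℝ (V → ℝ) :=
  Matrix.toLin' (Matrix.diagonal r * L)

theorem clockOperator_apply (L : Matrix V V ℝ) (r x : V → ℝ) (i : V) :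
    clockOperator L r x i = r i * L.mulVec x i := by
  rw [clockOperator, Matrix.toLin'_apply, ← Matrix.mulVec_mulVec, Matrix.mulVec_diagonal]

theorem clockOperator_eq_zero_iff_const (hloop : ∀ i, ¬ G.Adj i i)
    (hα : ∀ i j, G.Adj i j → 0 < α i j) (hconn : NetworkConnected G) (hr : ∀ i, 0 < r i)
    (x : V → ℝ) : clockOperator (networkLaplacian G α) r x = 0 ↔ ∃ c, x = fun _ => c := by
  rw [← mulVec_eq_zero_iff_const hloop hα hconn, funext_iff, funext_iff]
  refine forall_congr' fun i => ?_
  rw [clockOperator_apply]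
  simp [(hr i).ne']

theorem one_notMem_range_clockOperator [Nonempty V] (hloop : ∀ i, ¬ G.Adj i i)
    (hα : ∀ i j, G.Adj i j → 0 < α i j) (hr : ∀ i, 0 < r i) :
    (1 : V → ℝ) ∉ LinearMap.range (clockOperator (networkLaplacian G α) r) := by
  rintro ⟨x, hx⟩
  obtain ⟨m, hm⟩ := Finite.exists_min x
  have h1 := congrFun hx m
  rw [clockOperator_apply, Pi.one_apply] at h1
  nlinarith [mulVec_le_zero_of_isMin hloop hα hm, hr m]

theorem eigenvalue_nonneg [Nonempty V] (hloop : ∀ i, ¬ G.Adj i i)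
    (hα : ∀ i j, G.Adj i j → 0 < α i j) (hr : ∀ i, 0 < r i) {μ : ℝ} {v : V → ℝ} (hv : v ≠ 0)
    (hμ : clockOperator (networkLaplacian G α) r v = μ • v) : 0 ≤ μ := by
  by_contra! hneg
  -- at a minimizer, `μ x i = r i (L x) i ≤ 0` forces `0 ≤ x i`
  have key : ∀ x : V → ℝ, clockOperator (networkLaplacian G α) r x = μ • x → ∀ j, 0 ≤ x j := by
    intro x hx j
    obtain ⟨m, hm⟩ := Finite.exists_min x
    have h1 := congrFun hx m
    rw [clockOperator_apply, Pi.smul_apply, smul_eq_mul] at h1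
    have h2 := mul_nonneg (hr m).le (neg_nonneg.2 (mulVec_le_zero_of_isMin hloop hα hm))
    refine le_trans ?_ (hm j)
    by_contra! h3
    nlinarith
  apply hv
  funext j
  refine le_antisymm ?_ (key v hμ j)
  have := key (-v) (by rw [map_neg, hμ, smul_neg]) j
  simpa using this

theorem trace_pos [Nontrivial V] (hα : ∀ i j, G.Adj i j → 0 < α i j)
    (hconn : NetworkConnected G) (hr : ∀ i, 0 < r i) :
    0 < (networkLaplacian G α * Matrix.diagonal r).trace := by
  classical
  obtain ⟨root, hroot⟩ := hconn
  obtain ⟨i, hi⟩ := exists_ne root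
  obtain ⟨j, hij, -⟩ := (Relation.ReflTransGen.cases_head (hroot i)).resolve_left hi
  simp only [Matrix.trace, Matrix.diag_apply, Matrix.mul_diagonal, networkLaplacian,
    Matrix.of_apply, if_true]
  refine Finset.sum_pos' (fun k _ => mul_nonneg (Finset.sum_nonneg fun l hl => ?_) (hr k).le)
    ⟨i, Finset.mem_univ i, mul_pos (Finset.sum_pos (fun l hl => ?_) ⟨j, ?_⟩) (hr i)⟩
  · exact (hα k l (by simpa using hl)).le
  · exact hα i l (by simpa using hl)
  · simpa using hij

theorem charpoly_clockOperator (L : Matrix V V ℝ) (r : V → ℝ) :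
    (clockOperator L r).charpoly = (L * Matrix.diagonal r).charpoly := by
  rw [clockOperator, Matrix.charpoly_toLin', Matrix.charpoly_mul_comm]

theorem hasEigenvalue_clockOperator_iff (L : Matrix V V ℝ) (r : V → ℝ) (μ : ℝ) :
    Module.End.HasEigenvalue (clockOperator L r) μ ↔
      Module.End.HasEigenvalue (Matrix.toLin' (L * Matrix.diagonal r)) μ := by
  rw [Module.End.hasEigenvalue_iff_isRoot_charpoly, Module.End.hasEigenvalue_iff_isRoot_charpoly,
    charpoly_clockOperator, Matrix.charpoly_toLin']

theorem HasRealEigenvalues.splits_charpoly {M : Matrix V V ℝ} (h : HasRealEigenvalues M) :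
    M.charpoly.Splits := by
  refine Polynomial.Splits.of_splits_map Complex.ofRealHom
    (IsAlgClosed.splits _) fun a ha => ?_
  have hroot := Polynomial.isRoot_of_mem_roots ha
  rw [← Matrix.charpoly_map, ← Matrix.charpoly_toLin',
    ← Module.End.hasEigenvalue_iff_isRoot_charpoly] at hroot
  exact ⟨a.re, Complex.ext rfl (h a hroot).symm⟩

end Laplacian

/-! ### Trajectories of the system -/

section System

variable {V : Type*} [Fintype V] [DecidableEq V] (L : Matrix V V ℝ) (r : V → ℝ) (κ₁ κ₂ p τ : ℝ)

theorem systemMatrix_mulVec_clock (w : V ⊕ (V ⊕ V) → ℝ) (i : V) :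
    (systemMatrix L r κ₁ κ₂ p τ).mulVec w (Sum.inl i) =
      w (Sum.inl i) + τ * (r i * w (Sum.inr (Sum.inl i))) := by
  simp [systemMatrix, Matrix.fromBlocks_mulVec, Matrix.fromCols_mulVec, Matrix.smul_mulVec,
    Matrix.mulVec_diagonal]

theorem systemMatrix_mulVec_skew (w : V ⊕ (V ⊕ V) → ℝ) (i : V) :
    (systemMatrix L r κ₁ κ₂ p τ).mulVec w (Sum.inr (Sum.inl i)) =
      w (Sum.inr (Sum.inl i)) - κ₁ * L.mulVec (fun j => w (Sum.inl j)) i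
        - κ₂ * w (Sum.inr (Sum.inr i)) := by
  simp [systemMatrix, Matrix.fromBlocks_mulVec, Matrix.fromRows_mulVec, Matrix.smul_mulVec,
    Matrix.neg_mulVec, Function.comp_def]
  ring

theorem systemMatrix_mulVec_average (w : V ⊕ (V ⊕ V) → ℝ) (i : V) :
    (systemMatrix L r κ₁ κ₂ p τ).mulVec w (Sum.inr (Sum.inr i)) =
      (1 - p) * w (Sum.inr (Sum.inr i)) - p * L.mulVec (fun j => w (Sum.inl j)) i := by
  simp [systemMatrix, Matrix.fromBlocks_mulVec, Matrix.fromRows_mulVec, Matrix.smul_mulVec,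
    Matrix.neg_mulVec, Function.comp_def]
  ring

variable {L r κ₁ κ₂ p τ}

theorem clockRecurrence_of_trajectory {z : ℕ → (V ⊕ (V ⊕ V) → ℝ)}
    (hz : ∀ k, z (k + 1) = (systemMatrix L r κ₁ κ₂ p τ).mulVec (z k)) :
    ClockRecurrence (clockOperator L r) (τ * κ₁) (τ * (p * (κ₁ - κ₂))) p
      fun k i => z k (Sum.inl i) := by
  have hx : ∀ k i, z (k + 1) (Sum.inl i) = _ := fun k i =>
    (congrFun (hz k) _).trans (systemMatrix_mulVec_clock L r κ₁ κ₂ p τ (z k) i)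
  have hs : ∀ k i, z (k + 1) (Sum.inr (Sum.inl i)) = _ := fun k i =>
    (congrFun (hz k) _).trans (systemMatrix_mulVec_skew L r κ₁ κ₂ p τ (z k) i)
  have hy : ∀ k i, z (k + 1) (Sum.inr (Sum.inr i)) = _ := fun k i =>
    (congrFun (hz k) _).trans (systemMatrix_mulVec_average L r κ₁ κ₂ p τ (z k) i)
  intro k
  funext i
  simp only [map_sub, Pi.add_apply, Pi.sub_apply, Pi.smul_apply, smul_eq_mul,
    clockOperator_apply]
  rw [hx (k + 2), hs (k + 1), hx (k + 1), hs k, hy k]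
  generalize L.mulVec (fun j => z (k + 1) (Sum.inl j)) i = l
  rw [hx k]
  ring

/-- A real trajectory of the three-dimensional system by which the full system acts on the mode of
an eigenvalue `μ` of `R L`. -/
def ModeTrajectory (κ₁ κ₂ p τ μ : ℝ) (a b c : ℕ → ℝ) : Prop :=
  ∀ k, a (k + 1) = a k + τ * b k ∧ b (k + 1) = b k - κ₁ * μ * a k - κ₂ * c k ∧
    c (k + 1) = (1 - p) * c k - p * μ * a k

theorem Synchronizes.modeTrajectory (h : Synchronizes L r κ₁ κ₂ p τ) (hr : ∀ i, 0 < r i) {μ : ℝ}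
    {v : V → ℝ} (hv : clockOperator L r v = μ • v) {a b c : ℕ → ℝ}
    (habc : ModeTrajectory κ₁ κ₂ p τ μ a b c) :
    ∃ rs xs : ℝ, ∀ i,
      Tendsto (fun k : ℕ => a k * v i - (rs * ((k : ℝ) * τ) + xs)) atTop (𝓝 0) := by
  have hL : ∀ k i, L.mulVec (fun j => a k * v j) i = a k * (μ * v i / r i) := by
    intro k i
    have h1 := congrFun hv i
    rw [clockOperator_apply, Pi.smul_apply, smul_eq_mul] at h1
    have h2 : (fun j => a k * v j) = a k • v := rfl
    rw [h2, Matrix.mulVec_smul, Pi.smul_apply, smul_eq_mul, ← h1,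
      mul_div_cancel_left₀ _ (hr i).ne']
  refine h (fun k => Sum.elim (fun i => a k * v i)
    (Sum.elim (fun i => b k * v i / r i) fun i => c k * v i / r i)) fun k => ?_
  obtain ⟨ha, hb, hc⟩ := habc k
  funext i
  rcases i with i | i | i
  · rw [systemMatrix_mulVec_clock]
    simp only [Sum.elim_inl, Sum.elim_inr, ha]
    field_simp [(hr i).ne']
  · rw [systemMatrix_mulVec_skew]
    simp only [Sum.elim_inl, Sum.elim_inr, hL, hb]
    ring
  · rw [systemMatrix_mulVec_average]
    simp only [Sum.elim_inl, Sum.elim_inr, hL, hc]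
    ring

/-- On a mode whose eigenvector is not constant, synchronization means decay: two nodes with
different coordinates share the same limiting line. -/
theorem Synchronizes.modeTrajectory_tendsto_zero (h : Synchronizes L r κ₁ κ₂ p τ)
    (hr : ∀ i, 0 < r i) {μ : ℝ} {v : V → ℝ} (hv : clockOperator L r v = μ • v) {i j : V}
    (hij : v i ≠ v j) {a b c : ℕ → ℝ} (habc : ModeTrajectory κ₁ κ₂ p τ μ a b c) :
    Tendsto a atTop (𝓝 0) := by
  obtain ⟨rs, xs, hx⟩ := h.modeTrajectory hr hv habc
  have h1 := ((hx i).sub (hx j)).div_const (v i - v j)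
  rw [sub_zero, zero_div] at h1
  refine h1.congr fun k => ?_
  field_simp [sub_ne_zero.2 hij]
  ring

end System

/-! ### Necessity -/

theorem norm_one_add_lt_one_of_modes {κ₁ κ₂ p τ μ : ℝ} (hτ : τ ≠ 0)
    (h : ∀ a b c, ModeTrajectory κ₁ κ₂ p τ μ a b c → Tendsto a atTop (𝓝 0)) {q : ℂ} {c : ℕ → ℂ}
    (hc : ∀ k, c (k + 1) = (1 - p) * c k - p * μ * (1 + q) ^ k)
    (hq : ∀ k, q ^ 2 * (1 + q) ^ k = -(τ * κ₁ * μ * (1 + q) ^ k) - τ * κ₂ * c k) :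
    ‖1 + q‖ < 1 := by
  have hτ' : (τ : ℂ) ≠ 0 := Complex.ofReal_ne_zero.2 hτ
  have key : ∀ k, (1 + q) ^ (k + 1) = (1 + q) ^ k + τ * (q / τ * (1 + q) ^ k) ∧
      q / τ * (1 + q) ^ (k + 1) = q / τ * (1 + q) ^ k - κ₁ * μ * (1 + q) ^ k - κ₂ * c k := by
    intro k
    constructor
    · field_simp
      ring
    · apply mul_left_cancel₀ hτ'
      field_simp
      linear_combination hq k
  have hre := h (fun k => ((1 + q) ^ k).re) (fun k => (q / τ * (1 + q) ^ k).re)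
    (fun k => (c k).re) fun k => ⟨by beta_reduce; rw [(key k).1]; simp,
      by beta_reduce; rw [(key k).2]; simp, by beta_reduce; rw [hc k]; simp⟩
  have him := h (fun k => ((1 + q) ^ k).im) (fun k => (q / τ * (1 + q) ^ k).im)
    (fun k => (c k).im) fun k => ⟨by beta_reduce; rw [(key k).1]; simp,
      by beta_reduce; rw [(key k).2]; simp, by beta_reduce; rw [hc k]; simp⟩
  rw [← tendsto_pow_atTop_nhds_zero_iff_norm_lt_one]
  have h1 := ((Complex.continuous_ofReal.tendsto _).comp hre).add
    (((Complex.continuous_ofReal.tendsto _).comp him).mul_const Complex.I)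
  simp only [Complex.ofReal_zero, zero_mul, add_zero] at h1
  refine h1.congr fun k => ?_
  simp only [Function.comp_apply, Complex.re_add_im]

/-- Without the averaged feedback, a mode is a pair of roots `1 ± q`, one of which has modulus at
least one. -/
theorem kappa_two_ne_zero_of_modes {κ₁ κ₂ p τ μ : ℝ} (hτ : τ ≠ 0)
    (h : ∀ a b c, ModeTrajectory κ₁ κ₂ p τ μ a b c → Tendsto a atTop (𝓝 0)) : κ₂ ≠ 0 := by
  rintro rfl
  obtain ⟨q, hq, hre⟩ : ∃ q : ℂ, q ^ 2 = -(τ * κ₁ * μ) ∧ 0 ≤ q.re := by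
    obtain ⟨w, hw⟩ := IsAlgClosed.exists_eq_mul_self (-(τ * κ₁ * μ) : ℂ)
    rcases le_total 0 w.re with hw0 | hw0
    · exact ⟨w, by rw [hw, pow_two], hw0⟩
    · exact ⟨-w, by rw [hw]; ring, by simpa using hw0⟩
  have h1 := norm_one_add_lt_one_of_modes hτ h (q := q)
    (c := fun k => Nat.rec 0 (fun k y => (1 - p) * y - p * μ * (1 + q) ^ k) k)
    (fun k => rfl) fun k => by rw [hq]; push_cast; ring
  have h2 := Complex.re_le_norm (1 + q)
  simp only [Complex.add_re, Complex.one_re] at h2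
  linarith

theorem stableMode_of_modes {κ₁ κ₂ p τ μ : ℝ} (hτ : τ ≠ 0)
    (h : ∀ a b c, ModeTrajectory κ₁ κ₂ p τ μ a b c → Tendsto a atTop (𝓝 0)) :
    StableMode (τ * κ₁) (τ * (p * (κ₁ - κ₂))) p μ := by
  have hκ := kappa_two_ne_zero_of_modes hτ h
  have hκ' : (κ₂ : ℂ) ≠ 0 := Complex.ofReal_ne_zero.2 hκ
  have hτ' : (τ : ℂ) ≠ 0 := Complex.ofReal_ne_zero.2 hτ
  refine cubic_coeffs_of_stable fun q hq => ?_
  push_cast at hq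
  refine norm_one_add_lt_one_of_modes hτ h
    (c := fun k => -(q ^ 2 + τ * κ₁ * μ) / (τ * κ₂) * (1 + q) ^ k) (fun k => ?_) fun k => ?_
  · field_simp
    rw [pow_succ]
    linear_combination -(1 + q) ^ k * hq
  · field_simp
    ring

section Necessity

variable {V : Type*} [Fintype V] [DecidableEq V] [Nonempty V] {L : Matrix V V ℝ} {r : V → ℝ}
  {κ₁ κ₂ p τ : ℝ}

/-- On the constant mode the second difference of the clocks is a multiple of `(1 - p) ^ k`, which
has to vanish in the limit since affine sequences have no second difference. -/
theorem Synchronizes.p_mem (h : Synchronizes L r κ₁ κ₂ p τ) (hr : ∀ i, 0 < r i)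
    (hL : clockOperator L r 1 = 0) (hτ : τ ≠ 0) (hκ : κ₂ ≠ 0) : 0 < p ∧ p < 2 := by
  obtain ⟨rs, xs, hx⟩ := h.modeTrajectory hr (μ := 0) (v := 1) (by simpa using hL)
    (a := fun k => τ * ∑ j ∈ Finset.range k, -κ₂ * ∑ l ∈ Finset.range j, (1 - p) ^ l)
    (b := fun k => -κ₂ * ∑ j ∈ Finset.range k, (1 - p) ^ j) (c := fun k => (1 - p) ^ k)
    (fun k => ⟨by simp only [Finset.sum_range_succ]; ring,
      by simp only [Finset.sum_range_succ]; ring,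
      by ring⟩)
  have h0 := hx (Classical.arbitrary V)
  have h1 := (tendsto_add_atTop_iff_nat 1).2 h0
  have h2 := (tendsto_add_atTop_iff_nat 2).2 h0
  have h3 := ((h2.sub (h1.const_mul 2)).add h0).div_const (-(τ * κ₂))
  simp only [mul_zero, sub_zero, add_zero, zero_div] at h3
  have h4 : Tendsto (fun k => (1 - p) ^ k) atTop (𝓝 0) := by
    refine h3.congr fun k => ?_
    simp only [Finset.sum_range_succ]
    push_cast
    field_simp
    simp only [Pi.one_apply]
    ring
  rw [tendsto_pow_atTop_nhds_zero_iff, abs_lt] at h4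
  constructor <;> linarith

end Necessity

/-! ### Sufficiency -/

/-- The recurrence of the weighted mean of the clocks: the characteristic roots are `1`,
twice, and `1 - p`. -/
theorem exists_affine_add_geometric {p : ℝ} (hp : p ≠ 0) {a : ℕ → ℝ}
    (ha : ∀ k, a (k + 3) = (3 - p) * a (k + 2) - (3 - 2 * p) * a (k + 1) + (1 - p) * a k) :
    ∃ A B C : ℝ, ∀ k, a k = A + B * k + C * (1 - p) ^ k := by
  obtain ⟨C, hC⟩ : ∃ C, C * p ^ 2 = a 2 - 2 * a 1 + a 0 :=
    ⟨(a 2 - 2 * a 1 + a 0) / p ^ 2, by field_simp⟩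
  refine ⟨a 0 - C, a 1 - a 0 + C * p, C, fun k => ?_⟩
  suffices H : ∀ j ∈ [k, k + 1, k + 2],
      a j = a 0 - C + (a 1 - a 0 + C * p) * j + C * (1 - p) ^ j from H k (by simp)
  induction k with
  | zero =>
    simp only [List.mem_cons, List.not_mem_nil, or_false, zero_add]
    rintro j (rfl | rfl | rfl)
    · simp
    · push_cast; ring
    · push_cast; linear_combination -hC
  | succ k ih =>
    simp only [List.mem_cons, List.not_mem_nil, or_false] at ih ⊢
    rintro j (rfl | rfl | rfl)
    · exact ih _ (by simp)
    · exact ih _ (by simp [add_assoc])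
    · rw [show k + 1 + 2 = k + 3 from rfl, ha k, ih k (by simp), ih (k + 1) (by simp),
        ih (k + 2) (by simp)]
      push_cast
      ring

theorem tendsto_zero_of_map_of_functional {E : Type*} [NormedAddCommGroup E] [NormedSpace ℝ E]
    [FiniteDimensional ℝ E] {T : Module.End ℝ E} {w : E →ₗ[ℝ] ℝ}
    (hinj : ∀ v, T v = 0 → w v = 0 → v = 0) {x : ℕ → E}
    (hT : Tendsto (fun k => T (x k)) atTop (𝓝 0)) (hw : Tendsto (fun k => w (x k)) atTop (𝓝 0)) :
    Tendsto x atTop (𝓝 0) := by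
  obtain ⟨g, hg⟩ := (T.prod w).exists_leftInverse_of_injective <| by
    refine LinearMap.ker_eq_bot'.2 fun v hv => ?_
    exact hinj v (congrArg Prod.fst hv) (congrArg Prod.snd hv)
  have h1 := (g.continuous_of_finiteDimensional.tendsto _).comp (hT.prodMk_nhds hw)
  rw [show ((0 : E), (0 : ℝ)) = 0 from rfl, map_zero] at h1
  exact h1.congr fun k => LinearMap.congr_fun hg (x k)

theorem synchronizes_of_stableMode {V : Type*} [Fintype V] [DecidableEq V] {L : Matrix V V ℝ}
    {r : V → ℝ} {κ₁ κ₂ p τ : ℝ} (hp : 0 < p) (hp2 : p < 2) (hτ : τ ≠ 0)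
    (hker : ∀ x, clockOperator L r x = 0 ↔ ∃ c, x = fun _ => c)
    (hrange : (1 : V → ℝ) ∉ LinearMap.range (clockOperator L r))
    (hsplit : (clockOperator L r).charpoly.Splits)
    (hS : ∀ μ ∈ (clockOperator L r).charpoly.roots,
      μ = 0 ∨ StableMode (τ * κ₁) (τ * (p * (κ₁ - κ₂))) p μ) :
    Synchronizes L r κ₁ κ₂ p τ := by
  intro z hz
  set T := clockOperator L r with hTdef
  set x : ℕ → V → ℝ := fun k i => z k (Sum.inl i) with hxdef
  have hx : ClockRecurrence T (τ * κ₁) (τ * (p * (κ₁ - κ₂))) p x :=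
    clockRecurrence_of_trajectory hz
  -- a left null vector of `T`, normalized on the constants
  obtain ⟨w, hw1, hwT⟩ : ∃ w : (V → ℝ) →ₗ[ℝ] ℝ, w 1 = 1 ∧ ∀ v, w (T v) = 0 := by
    obtain ⟨f, hf1, hf⟩ := Submodule.exists_le_ker_of_notMem hrange
    exact ⟨(f 1)⁻¹ • f, by simp [hf1], fun v => by simp [LinearMap.mem_ker.1 (hf ⟨v, rfl⟩)]⟩
  have hinj : ∀ v, T v = 0 → w v = 0 → v = 0 := by
    intro v hTv hwv
    obtain ⟨c, rfl⟩ := (hker v).1 hTv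
    have h1 : (fun _ : V => c) = c • (1 : V → ℝ) := by ext; simp
    rw [h1, map_smul, hw1, smul_eq_mul, mul_one] at hwv
    rw [hwv]
    rfl
  have hTx : Tendsto (fun k => T (x k)) atTop (𝓝 0) := by
    refine ClockRecurrence.tendsto_zero_of_aeval_prod (T := T) hp hp2 (fun y hy hTy => ?_) _ hS _
      (hx.map (Commute.refl T)) (fun k => ⟨x k, rfl⟩) ?_
    · refine tendsto_zero_of_map_of_functional hinj hTy
        (tendsto_const_nhds.congr fun k => ?_)
      obtain ⟨v, hv⟩ := hy k
      rw [← hv, hwT]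
    · rw [← hsplit.eq_prod_roots_of_monic (LinearMap.charpoly_monic T),
        LinearMap.aeval_self_charpoly]
      exact tendsto_const_nhds
  obtain ⟨A, B, C, hABC⟩ := exists_affine_add_geometric hp.ne' (a := fun k => w (x k)) fun k => by
    simp only [hx k, map_add, map_sub, map_smul, smul_eq_mul, hwT, mul_zero, sub_zero]
  have hgeom : Tendsto (fun k => C * (1 - p) ^ k) atTop (𝓝 0) := by
    simpa using (tendsto_pow_atTop_nhds_zero_of_abs_lt_one
      (abs_lt.2 ⟨by linarith, by linarith⟩ : |1 - p| < 1)).const_mul C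
  refine ⟨B / τ, A, fun i => ?_⟩
  have h1 : Tendsto (fun k : ℕ => x k - (B / τ * (k * τ) + A) • (1 : V → ℝ)) atTop (𝓝 0) := by
    refine tendsto_zero_of_map_of_functional hinj (hTx.congr fun k => ?_)
      (hgeom.congr fun k => ?_)
    · rw [map_sub, map_smul, (hker 1).2 ⟨1, rfl⟩, smul_zero, sub_zero]
    · rw [map_sub, map_smul, hw1, hABC k]
      field_simp
      simp only [smul_eq_mul, mul_one]
      ring
  simpa [hxdef] using (tendsto_pi_nhds.1 h1) i

/-! ### The stability region -/

/-- The largest eigenvalue gives the most restrictive condition on the step size. -/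
theorem forall_stableMode_of_region {κ₁ κ₂ p τ μmax : ℝ} (hτ : 0 < τ) (hμmax : 0 < μmax)
    (hp : 0 < p) (h1 : 2 * κ₁ / (3 * p) > κ₁ - κ₂) (hδ : κ₁ - κ₂ > 0)
    (h3 : τ < p * (κ₂ - p * (κ₁ - κ₂)) / (μmax * (κ₁ - p * (κ₁ - κ₂)) ^ 2)) {μ : ℝ} (hμ : 0 < μ)
    (hle : μ ≤ μmax) : StableMode (τ * κ₁) (τ * (p * (κ₁ - κ₂))) p μ := by
  rw [gt_iff_lt, lt_div_iff₀ (by positivity)] at h1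
  obtain ⟨δ, rfl⟩ : ∃ δ, κ₂ = κ₁ - δ := ⟨κ₁ - κ₂, by ring⟩
  simp only [sub_sub_cancel] at *
  have he : 0 < κ₁ - p * δ := by nlinarith [mul_pos hp hδ]
  rw [lt_div_iff₀ (by positivity)] at h3
  have hm : τ * μ * (κ₁ - p * δ) ^ 2 < p * (κ₁ - δ - p * δ) :=
    lt_of_le_of_lt (by rw [mul_assoc]; gcongr) h3
  refine ⟨by positivity, ?_⟩
  have := mul_lt_mul_of_pos_left hm (mul_pos hτ hμ)
  linarith

theorem region_of_stableMode {κ₁ κ₂ p τ μ : ℝ} (hτ : 0 < τ) (hμ : 0 < μ)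
    (hp : 0 < p) (hp2 : p < 2) (h : StableMode (τ * κ₁) (τ * (p * (κ₁ - κ₂))) p μ) :
    (2 * κ₁ / (3 * p) > κ₁ - κ₂ ∧ κ₁ - κ₂ > 0) ∧
      τ < p * (κ₂ - p * (κ₁ - κ₂)) / (μ * (κ₁ - p * (κ₁ - κ₂)) ^ 2) := by
  obtain ⟨δ, rfl⟩ : ∃ δ, κ₂ = κ₁ - δ := ⟨κ₁ - κ₂, by ring⟩
  obtain ⟨h1, h2⟩ := h
  simp only [sub_sub_cancel] at *
  have hm : 0 < τ * μ := mul_pos hτ hμ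
  have hδ : 0 < δ := by
    have e : τ * (p * δ) * μ = τ * μ * p * δ := by ring
    rw [e] at h1
    exact pos_of_mul_pos_right h1 (mul_pos hm hp).le
  set b := τ * κ₁ * μ - τ * (p * δ) * μ with hb
  have hb0 : 0 < b := by
    by_contra! hb0
    nlinarith
  have hbm : b = τ * μ * (κ₁ - p * δ) := by rw [hb]; ring
  have he : 0 < κ₁ - p * δ := by
    rw [hbm] at hb0
    exact pos_of_mul_pos_right hb0 hm.le
  refine ⟨⟨?_, hδ⟩, ?_⟩
  · -- `γ < (p - b) b < 2 b`, that is `p δ < 2 (κ₁ - p δ)`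
    rw [gt_iff_lt, lt_div_iff₀ (by positivity)]
    have h4 : τ * (p * δ) * μ < 2 * b := by nlinarith
    rw [hbm] at h4
    have h5 : τ * μ * (p * δ) < τ * μ * (2 * (κ₁ - p * δ)) := by linarith
    linarith [lt_of_mul_lt_mul_left h5 hm.le]
  · rw [lt_div_iff₀ (by positivity)]
    rw [hbm] at h2
    refine lt_of_mul_lt_mul_left ?_ hm.le
    linarith

theorem theorem3 {V : Type*} [Fintype V] [DecidableEq V] [Nontrivial V]
    (G : Digraph V) (hloop : ∀ i, ¬ G.Adj i i)
    (α : V → V → ℝ) (hα : ∀ i j, G.Adj i j → 0 < α i j)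
    (hconn : NetworkConnected G)
    (r : V → ℝ) (hr : ∀ i, 0 < r i)
    (hreal : HasRealEigenvalues (networkLaplacian G α * Matrix.diagonal r))
    (μmax : ℝ)
    (hμ : IsGreatest {μ : ℝ | Module.End.HasEigenvalue
      (Matrix.toLin' (networkLaplacian G α * Matrix.diagonal r)) μ} μmax)
    (κ₁ κ₂ p τ : ℝ) (hτ : 0 < τ) :
    Synchronizes (networkLaplacian G α) r κ₁ κ₂ p τ ↔
      (0 < p ∧ p < 2) ∧
      (2 * κ₁ / (3 * p) > κ₁ - κ₂ ∧ κ₁ - κ₂ > 0) ∧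
      τ < p * (κ₂ - p * (κ₁ - κ₂)) / (μmax * (κ₁ - p * (κ₁ - κ₂)) ^ 2) := by
  set L := networkLaplacian G α with hLdef
  set T := clockOperator L r with hTdef
  have hker := clockOperator_eq_zero_iff_const hloop hα hconn hr
  have hsplit : T.charpoly.Splits := by
    rw [charpoly_clockOperator]
    exact hreal.splits_charpoly
  have heig : ∀ μ, Module.End.HasEigenvalue T μ → 0 ≤ μ ∧ μ ≤ μmax := by
    intro μ hev
    refine ⟨?_, hμ.2 ((hasEigenvalue_clockOperator_iff L r μ).1 hev)⟩
    obtain ⟨v, hv⟩ := hev.exists_hasEigenvector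
    exact eigenvalue_nonneg hloop hα hr hv.2 hv.apply_eq_smul
  have hroots : ∀ μ ∈ T.charpoly.roots, 0 ≤ μ ∧ μ ≤ μmax := fun μ hmem =>
    heig μ ((Module.End.hasEigenvalue_iff_isRoot_charpoly _ _).2
      (Polynomial.isRoot_of_mem_roots hmem))
  have hμmax : 0 < μmax := by
    by_contra! hneg
    have htr := trace_pos hα hconn hr
    rw [Matrix.trace_eq_sum_roots_charpoly_of_splits hreal.splits_charpoly,
      ← charpoly_clockOperator] at htr
    refine htr.not_ge ((Multiset.sum_le_card_nsmul _ 0 fun μ hmem =>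
      (hroots μ hmem).2.trans hneg).trans_eq (smul_zero _))
  constructor
  · intro h
    obtain ⟨v, hv⟩ := ((hasEigenvalue_clockOperator_iff L r μmax).2 hμ.1).exists_hasEigenvector
    -- an eigenvector of a nonzero eigenvalue is not constant
    obtain ⟨i, j, hij⟩ : ∃ i j, v i ≠ v j := by
      by_contra! hcon
      have h0 := (hker v).2 ⟨v (Classical.arbitrary V), funext fun i => hcon _ _⟩
      rw [hv.apply_eq_smul] at h0
      exact (smul_ne_zero hμmax.ne' hv.2) h0
    have hmodes := fun a b c => h.modeTrajectory_tendsto_zero (a := a) (b := b) (c := c) hr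
      hv.apply_eq_smul hij
    have hp := h.p_mem hr ((hker 1).2 ⟨1, rfl⟩) hτ.ne' (kappa_two_ne_zero_of_modes hτ.ne' hmodes)
    exact ⟨hp, region_of_stableMode hτ hμmax hp.1 hp.2 (stableMode_of_modes hτ.ne' hmodes)⟩
  · rintro ⟨⟨hp, hp2⟩, ⟨h1, h2⟩, h3⟩
    refine synchronizes_of_stableMode hp hp2 hτ.ne' hker
      (one_notMem_range_clockOperator hloop hα hr) hsplit fun μ hmem => ?_
    rcases (hroots μ hmem).1.eq_or_lt with h0 | hpos
    · exact Or.inl h0.symm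
    · exact Or.inr (forall_stableMode_of_region hτ hμmax hp h1 h2 h3 hpos (hroots μ hmem).2)
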